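/- \textbf{Model.} Let $K=K_N$ be integers with $1\le K_N\le N$ and $\tau=\tau_N\in(0,1)$, for all large $N$. Angles $X_1,\dots,X_N\in[0,2\pi)$ are observed (points of the circle $\mathbb R/2\pi\mathbb Z$; intervals $[\theta,\theta+2\pi\tau]$ are arcs, taken modulo $2\pi$). Under $H_0$, with law $\mathbb Q$, the $X_i$ are independent and uniform on the circle. Under $H_1$, with law $\mathbb P$, a set $S^*$ is drawn uniformly among the subsets of $\{1,\dots,N\}$ of size $K$ and, independently, a phase $\Theta^*$ is drawn uniformly on $[0,2\pi)$; given $(S^*,\Theta^*)$ the $X_i$ are independent, uniform on $[\Theta^*,\Theta^*+2\pi\tau]$ for $i\in S^*$ and uniform on the circle for $i\notin S^*$; $\mathbb P$ is the resulting mixture. A test is a measurable function $\phi$ of the data with values in $\{0,1\}$; put $p_{\mathrm{fa}}(\phi)=\mathbb Q\{\phi(X)=1\}$ and $p_{\mathrm{miss}}(\phi)=\mathbb P\{\phi(X)=0\}$. A sequence of tests $(\phi_N)$ achieves strong detection if $p_{\mathrm{fa}}(\phi_N)\to0$ and $p_{\mathrm{miss}}(\phi_N)\to0$ as $N\to\infty$.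 Weak detection is impossible if every sequence of tests satisfies $p_{\mathrm{fa}}(\phi_N)+p_{\mathrm{miss}}(\phi_N)\ge 1-o(1)$. The interval test with threshold $\gamma$ (a real number) rejects $H_0$ if and only if $\sup_{\theta}\sum_{i=1}^N \mathbf 1\{X_i\in[\theta,\theta+2\pi\tau]\}\ge\gamma$. \textbf{Theorem.} (a) (Achievability) The interval test with threshold $\gamma$ achieves strong detection in each of the following two cases: (A1) $\gamma=K$ and $\dfrac{N^K\tau^{K-1}}{(K-1)!}\to0$; (A2) $\gamma=\gamma_N$, where for some sequence $c_N\to\infty$ \[\gamma_N=(N-K)\tau+K-c_N\sqrt{(N-K)\tau},\qquad \gamma_N\ge 1+(N-1)\tau\ \text{ for all sufficiently large } N,\] and \[\frac{(K-1)^2(1-\tau)^2}{(N-K)\tau}\to\infty,\qquad \frac{\big(K(1-\tau)-c_N\sqrt{(N-K)\tau}\big)^2}{2N\tau+K(1-\tau)-c_N\sqrt{(N-K)\tau}}-\log N\to\infty\] (in particular $K<N$ for all large $N$, so that the first quotient is defined). (b) (Converse) If $\tau\le 1/2$ for all sufficiently large $N$ and \[\frac{2N\tau^2}{K^2}\Big(1+\frac{K}{N\tau}\Big)^{K+1}\to0,\]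 then weak detection is impossible. -/

import Mathlib

open MeasureTheory ProbabilityTheory Filter Topology
open scoped ENNReal

namespace HardCluster

/-- The circle has positive circumference `2π`. -/
instance instTwoPiPos : Fact (0 < 2 * Real.pi) := ⟨Real.two_pi_pos⟩

/-- Angles, that is, points of `ℝ / 2πℤ`, identified with `[0, 2π)`. -/
abbrev Angle : Type := AddCircle (2 * Real.pi)

/-- The uniform distribution on the circle `[0, 2π)`. -/
noncomputable def unifCircle : Measure Angle := AddCircle.haarAddCircle

/-- The closed arc `[θ, θ + 2πτ]`, taken modulo `2π`. -/
def arc (τ : ℝ) (θ : Angle) : Set Angle :=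
  (fun t : ℝ => θ + (t : Angle)) '' Set.Icc 0 (2 * Real.pi * τ)

/-- The uniform distribution on the arc `[θ, θ + 2πτ]`. -/
noncomputable def unifArc (τ : ℝ) (θ : Angle) : Measure Angle :=
  ProbabilityTheory.cond unifCircle (arc τ θ)

/-- The law `ℚ` of the observations under `H₀`: `N` independent uniform angles. -/
noncomputable def nullLaw (N : ℕ) : Measure (Fin N → Angle) :=
  Measure.pi fun _ => unifCircle

/-- The conditional law of the observations under `H₁` given the planted set `S` and the planted
phase `θ`: independent angles, uniform on the arc for indices in `S` and on the circle otherwise. -/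
noncomputable def condLaw (N : ℕ) (τ : ℝ) (S : Finset (Fin N)) (θ : Angle) :
    Measure (Fin N → Angle) :=
  Measure.pi fun i => if i ∈ S then unifArc τ θ else unifCircle

/-- The law `ℙ` of the observations under `H₁`: the mixture of the conditional laws over a planted
set `S` uniform among the subsets of size `K` and an independent uniform planted phase `θ`. -/
noncomputable def plantedLaw (N K : ℕ) (τ : ℝ) : Measure (Fin N → Angle) :=
  (((Finset.univ : Finset (Fin N)).powersetCard K).card : ℝ≥0∞)⁻¹ •
    ∑ S ∈ (Finset.univ : Finset (Fin N)).powersetCard K,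
      unifCircle.bind fun θ => condLaw N τ S θ

/-- False alarm probability `ℚ{φ(X) = 1}` of a `{0,1}`-valued test
(`true` stands for `1`, the rejection of `H₀`). -/
noncomputable def pFalseAlarm {N : ℕ} (φ : (Fin N → Angle) → Bool) : ℝ :=
  (nullLaw N).real {x | φ x = true}

/-- Miss probability `ℙ{φ(X) = 0}` of a test. -/
noncomputable def pMiss {N : ℕ} (K : ℕ) (τ : ℝ) (φ : (Fin N → Angle) → Bool) : ℝ :=
  (plantedLaw N K τ).real {x | φ x = false}

/-- The sequence of tests `φ` (the `N`-th one for `N` observations) achieves strong detection. -/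
def AchievesStrongDetection (K : ℕ → ℕ) (τ : ℕ → ℝ)
    (φ : (N : ℕ) → (Fin N → Angle) → Bool) : Prop :=
  (∀ N, Measurable (φ N)) ∧
    Tendsto (fun N => pFalseAlarm (φ N)) atTop (𝓝 0) ∧
    Tendsto (fun N => pMiss (K N) (τ N) (φ N)) atTop (𝓝 0)

/-- Weak detection is impossible: every sequence of tests satisfies `p_fa + p_miss ≥ 1 - o(1)`. -/
def WeakDetectionImpossible (K : ℕ → ℕ) (τ : ℕ → ℝ) : Prop :=
  ∀ φ : (N : ℕ) → (Fin N → Angle) → Bool, (∀ N, Measurable (φ N)) →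
    ∀ ε : ℝ, 0 < ε → ∀ᶠ N in atTop, 1 - ε ≤ pFalseAlarm (φ N) + pMiss (K N) (τ N) (φ N)

/-- The interval statistic: the largest number of observations in an arc of length `2πτ`. -/
noncomputable def intervalStat {N : ℕ} (τ : ℝ) (x : Fin N → Angle) : ℕ :=
  ⨆ θ : Angle, {i : Fin N | x i ∈ arc τ θ}.ncard

open Classical in
/-- The interval test with window length `2πτ` and threshold `γ`:
it rejects `H₀` if and only if the interval statistic is at least `γ`. -/
noncomputable def intervalTest {N : ℕ} (τ γ : ℝ) (x : Fin N → Angle) : Bool :=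
  decide (γ ≤ (intervalStat τ x : ℝ))

end HardCluster

/-! Achievability. An arc that holds at least γ points still holds them after its start is moved
forward to the first of them (`exists_sub_one_le_hits`). The supremum over phases therefore costs
only a factor N under the null law: given the starting point, the other N - 1 points are independent
and uniform, and a binomial(N - 1, τ) count must reach γ - 1. A union bound over subsets
(`pi_le_hits_le`) handles γ = K, a Chernoff bound (`pi_rpow_le_hits_le`) the threshold of (A2).
Under the planted law the planted arc almost surely contains all K planted points. Hence γ = K is
never missed, and in (A2) a miss forces a binomial(N - K, τ) background count to fall c√((N - K)τ)
below its mean, an event of probability at most exp(1/2 - c).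

Converse. By the second moment method it suffices that the likelihood ratio L satisfies E L² ≤ 1 +
o(1) under the null law. Expanding the square gives two independent copies (S, θ), (S', θ'); only
indices in S ∩ S' matter, each contributing τ⁻² times the measure of the overlap of the two arcs.
For τ ≤ 1/2 the overlap is a tent function of the relative phase, with h-th moment at most
2τ^(h+1)/(h+1) for h ≥ 1 (`lintegral_arc_inter_pow_le`). Averaging τ^(-h)/(h+1) over the
hypergeometric size h of S ∩ S' is reduced to a binomial sum
(`sum_powersetCard_pow_card_inter_div_le`), which yields exactly the quantity in (b). -/

namespace HardCluster

/-! ### Arcs: measurability and length -/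

instance : IsProbabilityMeasure unifCircle :=
  inferInstanceAs (IsProbabilityMeasure AddCircle.haarAddCircle)

instance : unifCircle.IsAddLeftInvariant :=
  inferInstanceAs (AddCircle.haarAddCircle : Measure Angle).IsAddLeftInvariant

instance (N : ℕ) : IsProbabilityMeasure (nullLaw N) :=
  inferInstanceAs (IsProbabilityMeasure (Measure.pi _))

theorem mem_arc_iff {τ : ℝ} {θ x : Angle} :
    x ∈ arc τ θ ↔ ∃ t ∈ Set.Icc 0 (2 * Real.pi * τ), θ + (t : Angle) = x := Iff.rfl

theorem arc_zero_eq (τ : ℝ) :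
    arc τ 0 = (fun t : ℝ => (t : Angle)) '' Set.Icc 0 (2 * Real.pi * τ) := by
  simp [arc]

theorem mem_arc_iff_sub_mem {τ : ℝ} {θ x : Angle} : x ∈ arc τ θ ↔ x - θ ∈ arc τ 0 := by
  simp only [mem_arc_iff, zero_add, eq_sub_iff_add_eq, add_comm]

theorem isCompact_arc_zero (τ : ℝ) : IsCompact (arc τ 0) := by
  rw [arc_zero_eq]
  exact isCompact_Icc.image (AddCircle.continuous_mk' _)

theorem isClosed_arc_rel (τ : ℝ) : IsClosed {p : Angle × Angle | p.1 ∈ arc τ p.2} := by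
  have : {p : Angle × Angle | p.1 ∈ arc τ p.2} = (fun p => p.1 - p.2) ⁻¹' arc τ 0 := by
    ext p; exact mem_arc_iff_sub_mem
  rw [this]
  exact (isCompact_arc_zero τ).isClosed.preimage (by fun_prop)

theorem isClosed_arc (τ : ℝ) (θ : Angle) : IsClosed (arc τ θ) :=
  (isClosed_arc_rel τ).preimage (f := fun x => (x, θ)) (by fun_prop)

theorem measurableSet_arc (τ : ℝ) (θ : Angle) : MeasurableSet (arc τ θ) :=
  (isClosed_arc τ θ).measurableSet

theorem unifCircle_apply (a : ℝ) {s : Set Angle} (hs : MeasurableSet s) :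
    unifCircle s = (ENNReal.ofReal (2 * Real.pi))⁻¹ *
      volume ((fun t : ℝ => (t : Angle)) ⁻¹' s ∩ Set.Ioc a (a + 2 * Real.pi)) := by
  have h := AddCircle.add_projection_respects_measure (2 * Real.pi) a hs
  rw [AddCircle.volume_eq_smul_haarAddCircle, Measure.smul_apply, smul_eq_mul] at h
  have h0 : ENNReal.ofReal (2 * Real.pi) ≠ 0 := by simp [Real.pi_pos]
  rw [show (fun t : ℝ => (t : Angle)) ⁻¹' s = QuotientAddGroup.mk ⁻¹' s from rfl, ← h,
    ← mul_assoc, ENNReal.inv_mul_cancel h0 ENNReal.ofReal_ne_top, one_mul]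
  rfl

theorem lintegral_unifCircle (a : ℝ) (f : Angle → ℝ≥0∞) :
    ∫⁻ x, f x ∂unifCircle =
      (ENNReal.ofReal (2 * Real.pi))⁻¹ *
        ∫⁻ t in Set.Ioc a (a + 2 * Real.pi), f (t : Angle) := by
  have h := AddCircle.lintegral_preimage (2 * Real.pi) a f
  rw [AddCircle.volume_eq_smul_haarAddCircle, lintegral_smul_measure, smul_eq_mul] at h
  have h0 : ENNReal.ofReal (2 * Real.pi) ≠ 0 := by simp [Real.pi_pos]
  rw [h, ← mul_assoc, ENNReal.inv_mul_cancel h0 ENNReal.ofReal_ne_top, one_mul]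
  rfl

theorem unifCircle_image_Icc {a b : ℝ} (hab : b - a < 2 * Real.pi) :
    unifCircle ((fun t : ℝ => (t : Angle)) '' Set.Icc a b) =
      ENNReal.ofReal ((b - a) / (2 * Real.pi)) := by
  have hm : MeasurableSet ((fun t : ℝ => (t : Angle)) '' Set.Icc a b) :=
    (isCompact_Icc.image (AddCircle.continuous_mk' _)).isClosed.measurableSet
  -- On the half-open period ending at `b` the projection to the circle is injective, and `b - a <
  -- 2π` makes `[a, b]` fit inside.
  have hsub : Set.Icc a b ⊆ Set.Ioc (b - 2 * Real.pi) (b - 2 * Real.pi + 2 * Real.pi) :=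
    fun t ht => ⟨by linarith [ht.1], by linarith [ht.2]⟩
  have hset : (fun t : ℝ => (t : Angle)) ⁻¹' ((fun t : ℝ => (t : Angle)) '' Set.Icc a b) ∩
      Set.Ioc (b - 2 * Real.pi) (b - 2 * Real.pi + 2 * Real.pi) = Set.Icc a b := by
    ext t
    constructor
    · rintro ⟨⟨s, hs, hst⟩, ht⟩
      rwa [← (AddCircle.coe_eq_coe_iff_of_mem_Ioc (hsub hs) ht).1 hst]
    · exact fun ht => ⟨⟨t, ht, rfl⟩, hsub ht⟩
  rw [unifCircle_apply (b - 2 * Real.pi) hm, hset, Real.volume_Icc, mul_comm,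
    ENNReal.ofReal_div_of_pos Real.two_pi_pos, div_eq_mul_inv]

theorem preimage_arc (τ : ℝ) (θ : Angle) : arc τ θ = (fun x => -θ + x) ⁻¹' arc τ 0 := by
  ext x
  rw [mem_arc_iff_sub_mem]
  simp [sub_eq_neg_add]

theorem unifCircle_arc {τ : ℝ} (h1 : τ < 1) (θ : Angle) :
    unifCircle (arc τ θ) = ENNReal.ofReal τ := by
  have hπ := Real.two_pi_pos
  rw [preimage_arc, measure_preimage_add, arc_zero_eq, unifCircle_image_Icc (by nlinarith),
    sub_zero, mul_div_cancel_left₀ _ hπ.ne']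

/-! ### Overlap of two arcs -/

theorem arc_zero_inter_arc_subset {τ δ : ℝ} (h : τ ≤ 1 / 2) (hδ : |δ| < Real.pi) :
    arc τ 0 ∩ arc τ (δ : Angle) ⊆ (fun t : ℝ => (t : Angle)) ''
      Set.Icc (max 0 δ) (min (2 * Real.pi * τ) (2 * Real.pi * τ + δ)) := by
  rintro x ⟨h1, h2⟩
  obtain ⟨t, ht, rfl⟩ := mem_arc_iff.1 h1
  obtain ⟨s, hs, hst⟩ := mem_arc_iff.1 h2
  have hπ := Real.pi_pos
  have hτ : 2 * Real.pi * τ ≤ Real.pi := by nlinarith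
  rw [abs_lt] at hδ
  have hz : ((δ + s - t : ℝ) : Angle) = 0 := by
    rw [AddCircle.coe_sub, AddCircle.coe_add, hst]
    simp
  obtain ⟨n, hn⟩ := (AddCircle.coe_eq_zero_iff _).1 hz
  rw [zsmul_eq_mul] at hn
  -- Offsets `s`, `t` lie in `[0, π]` because `τ ≤ 1/2`, so `|δ + s - t| < 2π`: short arcs cannot
  -- meet again around the back of the circle.
  have hn0 : n = 0 := by
    have h3 : (n : ℝ) < 1 := by
      by_contra! h3
      nlinarith [hs.1, hs.2, ht.1, ht.2]
    have h4 : (-1 : ℝ) < n := by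
      by_contra! h4
      nlinarith [hs.1, hs.2, ht.1, ht.2]
    have h3' : n < 1 := by exact_mod_cast h3
    have h4' : -1 < n := by exact_mod_cast h4
    omega
  rw [hn0] at hn
  have : t = δ + s := by push_cast at hn; linarith
  exact ⟨t, ⟨max_le ht.1 (by linarith [hs.1]), le_min ht.2 (by linarith [hs.2])⟩, by simp⟩

theorem unifCircle_arc_inter_le {τ δ : ℝ} (h : τ ≤ 1 / 2) (hδ : |δ| < Real.pi) :
    unifCircle (arc τ 0 ∩ arc τ (δ : Angle)) ≤
      ENNReal.ofReal ((2 * Real.pi * τ - |δ|) / (2 * Real.pi)) := by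
  have hπ := Real.pi_pos
  have hlen : min (2 * Real.pi * τ) (2 * Real.pi * τ + δ) - max 0 δ = 2 * Real.pi * τ - |δ| := by
    rcases le_total 0 δ with h0 | h0
    · rw [min_eq_left (by linarith), max_eq_right h0, abs_of_nonneg h0]
    · rw [min_eq_right (by linarith), max_eq_left h0, abs_of_nonpos h0]
      ring
  refine (measure_mono (arc_zero_inter_arc_subset h hδ)).trans ?_
  rw [unifCircle_image_Icc, hlen]
  rw [hlen]
  nlinarith [abs_nonneg δ]

theorem integral_sub_abs_pow {c : ℝ} (hc : 0 ≤ c) (h : ℕ) :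
    ∫ t in (-c)..c, (c - |t|) ^ h = 2 * c ^ (h + 1) / (h + 1) := by
  have hcont : Continuous fun t : ℝ => (c - |t|) ^ h := by fun_prop
  have h1 : ∫ t in (0 : ℝ)..c, (c - |t|) ^ h = c ^ (h + 1) / (h + 1) := by
    have : ∫ t in (0 : ℝ)..c, (c - |t|) ^ h = ∫ t in (0 : ℝ)..c, (c - t) ^ h := by
      refine intervalIntegral.integral_congr fun t ht => ?_
      rw [Set.uIcc_of_le hc] at ht
      simp only [abs_of_nonneg ht.1]
    rw [this, intervalIntegral.integral_comp_sub_left (fun t => t ^ h)]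
    simp
  have h2 : ∫ t in (-c)..0, (c - |t|) ^ h = ∫ t in (0 : ℝ)..c, (c - |t|) ^ h := by
    have := intervalIntegral.integral_comp_neg (a := 0) (b := c) (fun t : ℝ => (c - |t|) ^ h)
    simpa using this.symm
  rw [← intervalIntegral.integral_add_adjacent_intervals
    (hcont.intervalIntegrable _ _) (hcont.intervalIntegrable 0 _), h2, h1]
  ring

/-- The moments of the overlap of two arcs with uniform relative phase. -/
theorem lintegral_arc_inter_pow_le {τ : ℝ} (h0 : 0 < τ) (h1 : τ ≤ 1 / 2) {h : ℕ} (hh : h ≠ 0) :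
    ∫⁻ δ, unifCircle (arc τ 0 ∩ arc τ δ) ^ h ∂unifCircle ≤
      ENNReal.ofReal (2 * τ ^ (h + 1) / (h + 1)) := by
  have hπ := Real.pi_pos
  set c := 2 * Real.pi * τ with hc
  have hc0 : 0 < c := by positivity
  rw [lintegral_unifCircle (-Real.pi)]
  have hb : ∫⁻ t in Set.Ioc (-Real.pi) (-Real.pi + 2 * Real.pi),
      unifCircle (arc τ 0 ∩ arc τ (t : Angle)) ^ h ≤
      ∫⁻ t in Set.Ioc (-c) c, ENNReal.ofReal (((c - |t|) / (2 * Real.pi)) ^ h) := by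
    -- The endpoint is dropped because the overlap bound needs `|t| < π` strictly.
    rw [← Measure.restrict_congr_set Ioo_ae_eq_Ioc, ← lintegral_indicator measurableSet_Ioo,
      ← lintegral_indicator measurableSet_Ioc]
    refine lintegral_mono_ae ?_
    filter_upwards with t
    by_cases ht : t ∈ Set.Ioo (-Real.pi) (-Real.pi + 2 * Real.pi)
    · rw [Set.indicator_of_mem ht]
      have hle := unifCircle_arc_inter_le h1
        (abs_lt.2 ⟨ht.1, by linarith [ht.2]⟩ : |t| < Real.pi)
      by_cases htc : t ∈ Set.Ioc (-c) c
      · rw [Set.indicator_of_mem htc]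
        have : |t| ≤ c := abs_le.2 ⟨htc.1.le, htc.2⟩
        rw [ENNReal.ofReal_pow (div_nonneg (by linarith) (by positivity))]
        exact pow_le_pow_left' hle h
      -- Here the arcs overlap in a null set; `h ≠ 0` is what makes its `h`-th power vanish.
      · have : c ≤ |t| := by
          by_contra! hlt
          exact htc ⟨(abs_lt.1 hlt).1, (abs_lt.1 hlt).2.le⟩
        rw [ENNReal.ofReal_of_nonpos (div_nonpos_of_nonpos_of_nonneg (by linarith)
          (by positivity))] at hle
        simp [le_antisymm hle bot_le, hh]
    · simp [Set.indicator_of_notMem ht]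
  have hint : IntegrableOn (fun t : ℝ => ((c - |t|) / (2 * Real.pi)) ^ h) (Set.Ioc (-c) c) := by
    have : Continuous fun t : ℝ => ((c - |t|) / (2 * Real.pi)) ^ h := by fun_prop
    exact (this.intervalIntegrable (-c) c).1
  refine (mul_le_mul_right hb _).trans ?_
  rw [← ofReal_integral_eq_lintegral_ofReal hint, ← intervalIntegral.integral_of_le (by linarith)]
  · simp_rw [div_pow]
    rw [intervalIntegral.integral_div, integral_sub_abs_pow hc0.le,
      ← ENNReal.ofReal_inv_of_pos Real.two_pi_pos, ← ENNReal.ofReal_mul (by positivity)]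
    apply ENNReal.ofReal_le_ofReal
    rw [hc, mul_pow]
    apply le_of_eq
    field_simp
    ring
  · refine (ae_restrict_iff' measurableSet_Ioc).2 (ae_of_all _ fun t ht => ?_)
    have : |t| ≤ c := abs_le.2 ⟨ht.1.le, ht.2⟩
    exact pow_nonneg (div_nonneg (by linarith) (by positivity)) h

/-! ### Hit counts and binomial tails -/

section Hits

variable {ι α : Type*}

open Classical in
/-- The number of indices in `T` at which the family `y` lies in `B`. -/
noncomputable def hits (T : Finset ι) (B : Set α) (y : ι → α) : ℕ :=
  (T.filter fun i => y i ∈ B).card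

theorem ncard_eq_hits [Fintype ι] (B : Set α) (y : ι → α) :
    {i | y i ∈ B}.ncard = hits Finset.univ B y := by
  classical
  rw [hits, Set.ncard_eq_toFinset_card', Set.toFinset_ofFinset]
  congr

theorem measurable_hits_rel [MeasurableSpace α] {β : Type*} [MeasurableSpace β] (T : Finset ι)
    {B : β → Set α} (hB : MeasurableSet {p : α × β | p.1 ∈ B p.2}) :
    Measurable fun p : β × (ι → α) => hits T (B p.1) p.2 := by
  classical
  simp only [hits, Finset.card_filter]
  refine Finset.measurable_sum _ fun i _ => ?_
  refine Measurable.ite ?_ measurable_const measurable_const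
  exact hB.preimage (f := fun p : β × (ι → α) => (p.2 i, p.1)) (by fun_prop)

variable [Fintype ι] [MeasurableSpace α]

theorem lintegral_pi_prod (μ : ι → Measure α) [∀ i, IsProbabilityMeasure (μ i)] (T : Finset ι)
    {f : ι → α → ℝ≥0∞} (hf : ∀ i, Measurable (f i)) :
    ∫⁻ y, ∏ i ∈ T, f i (y i) ∂Measure.pi μ = ∏ i ∈ T, ∫⁻ a, f i a ∂μ i := by
  rw [lintegral_prod_eq_prod_lintegral_of_indepFun T (fun i (y : ι → α) => f i (y i))
    (iIndepFun_pi fun i => (hf i).aemeasurable) fun i => (hf i).comp (measurable_pi_apply i)]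
  refine Finset.prod_congr rfl fun i _ => ?_
  exact (measurePreserving_eval μ i).lintegral_comp (hf i)

/-- Union bound for binomial upper tails. -/
theorem pi_le_hits_le (ν : Measure α) [IsProbabilityMeasure ν] (B : Set α) (k : ℕ) :
    (Measure.pi fun _ : ι => ν) {y | k ≤ hits Finset.univ B y} ≤
      (Fintype.card ι).choose k * ν B ^ k := by
  classical
  have hsub : {y : ι → α | k ≤ hits Finset.univ B y} ⊆
      ⋃ T ∈ (Finset.univ : Finset ι).powersetCard k,
        Set.pi Set.univ fun i => if i ∈ T then B else Set.univ := by
    intro y hy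
    obtain ⟨T, hT, hTk⟩ := Finset.exists_subset_card_eq hy
    simp only [Set.mem_iUnion]
    refine ⟨T, Finset.mem_powersetCard.2 ⟨Finset.subset_univ T, hTk⟩, fun i _ => ?_⟩
    by_cases hi : i ∈ T
    · simpa [hi] using (Finset.mem_filter.1 (hT hi)).2
    · simp [hi]
  refine (measure_mono hsub).trans ((measure_biUnion_finset_le _ _).trans ?_)
  rw [← Finset.card_univ, ← Finset.card_powersetCard, ← nsmul_eq_mul]
  refine Finset.sum_le_card_nsmul _ _ _ fun T hT => ?_
  rw [Measure.pi_pi]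
  simp_rw [apply_ite ν, measure_univ]
  rw [Finset.prod_ite_mem, Finset.univ_inter, Finset.prod_const, (Finset.mem_powersetCard.1 hT).2]

/-- Chernoff bound for binomial tails: the lower tail for `y ≤ 1`, the upper one for `y ≥ 1`. -/
theorem pi_rpow_le_hits_le (μ : ι → Measure α) [∀ i, IsProbabilityMeasure (μ i)] (T : Finset ι)
    {B : Set α} (hB : MeasurableSet B) {p : ℝ} (hp0 : 0 ≤ p)
    (hp : ∀ i ∈ T, μ i B = ENNReal.ofReal p) {y : ℝ} (hy : 0 < y) (m : ℝ) :
    Measure.pi μ {x | y ^ m ≤ y ^ (hits T B x : ℝ)} ≤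
      ENNReal.ofReal (Real.exp (T.card * p * (y - 1) - m * Real.log y)) := by
  classical
  let f : α → ℝ≥0∞ := fun a => if a ∈ B then ENNReal.ofReal y else 1
  have hf : Measurable f := Measurable.ite hB measurable_const measurable_const
  have hprod : ∀ x : ι → α, ∏ i ∈ T, f (x i) = ENNReal.ofReal (y ^ (hits T B x : ℝ)) := by
    intro x
    rw [Real.rpow_natCast, ENNReal.ofReal_pow hy.le, hits, ← Finset.prod_const,
      Finset.prod_filter]
  have hint : ∀ i ∈ T, ∫⁻ a, f a ∂μ i ≤ ENNReal.ofReal (Real.exp (p * (y - 1))) := by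
    intro i hi
    have hp1 : p ≤ 1 := by
      have := prob_le_one (μ := μ i) (s := B)
      rw [hp i hi] at this
      simpa using this
    have hc : μ i Bᶜ = ENNReal.ofReal (1 - p) := by
      rw [prob_compl_eq_one_sub hB, hp i hi, ENNReal.ofReal_sub _ hp0, ENNReal.ofReal_one]
    have : ∫⁻ a, f a ∂μ i = ENNReal.ofReal y * μ i B + μ i Bᶜ := by
      rw [← lintegral_add_compl f hB]
      congr 1
      · rw [setLIntegral_congr_fun hB (g := fun _ => ENNReal.ofReal y) fun a ha => by
          simp only [f, if_pos ha]]
        simp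
      · rw [setLIntegral_congr_fun hB.compl (g := fun _ => 1) fun a ha => by
          simp only [f, if_neg (show a ∉ B from ha)]]
        simp
    rw [this, hp i hi, hc, ← ENNReal.ofReal_mul hy.le,
      ← ENNReal.ofReal_add (by positivity) (by linarith)]
    apply ENNReal.ofReal_le_ofReal
    -- The generating function `1 + p(y - 1)` of one indicator is bounded by the Poisson one.
    have := Real.add_one_le_exp (p * (y - 1))
    linarith
  have hset : {x : ι → α | y ^ m ≤ y ^ (hits T B x : ℝ)} ⊆
      {x | ENNReal.ofReal (y ^ m) ≤ ∏ i ∈ T, f (x i)} := by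
    intro x hx
    rw [Set.mem_ofPred_eq, hprod]
    exact ENNReal.ofReal_le_ofReal hx
  have hpos : 0 < y ^ m := Real.rpow_pos_of_pos hy m
  have hmark := mul_meas_ge_le_lintegral (μ := Measure.pi μ)
    (f := fun x : ι → α => ∏ i ∈ T, f (x i))
    (Finset.measurable_prod _ fun i _ => hf.comp (measurable_pi_apply i)) (ENNReal.ofReal (y ^ m))
  rw [lintegral_pi_prod μ T fun _ => hf] at hmark
  have hle := hmark.trans (Finset.prod_le_prod' hint)
  rw [Finset.prod_const, ← ENNReal.ofReal_pow (Real.exp_pos _).le, ← Real.exp_nat_mul, mul_comm,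
    ← ENNReal.le_div_iff_mul_le (by simp [hpos]) (by simp), ← ENNReal.ofReal_div_of_pos hpos,
    Real.rpow_def_of_pos hy, ← Real.exp_sub] at hle
  refine (measure_mono hset).trans ?_
  rw [Real.rpow_def_of_pos hy]
  rwa [mul_comm m, mul_assoc]

end Hits

/-! ### The interval statistic and its null tail -/

theorem le_intervalStat_iff {N : ℕ} {τ γ : ℝ} {x : Fin N → Angle} :
    γ ≤ (intervalStat τ x : ℝ) ↔ ∃ θ, γ ≤ (hits Finset.univ (arc τ θ) x : ℝ) := by
  have hbdd : BddAbove (Set.range fun θ : Angle => {i : Fin N | x i ∈ arc τ θ}.ncard) := by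
    refine ⟨N, ?_⟩
    rintro _ ⟨θ, rfl⟩
    simpa using Set.ncard_le_ncard (Set.subset_univ {i : Fin N | x i ∈ arc τ θ})
  constructor
  · intro h
    -- A bounded nonempty set of naturals attains its supremum, so some phase is optimal.
    obtain ⟨θ, hθ⟩ := Nat.sSup_mem (Set.range_nonempty _) hbdd
    refine ⟨θ, h.trans ?_⟩
    rw [← ncard_eq_hits]
    exact_mod_cast hθ.ge
  · rintro ⟨θ, hθ⟩
    refine hθ.trans ?_
    rw [← ncard_eq_hits]
    exact_mod_cast le_ciSup hbdd θ

/-- The union over phases is uncountable. For a fixed index set, however, the configurations covered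
by some arc form the projection of a closed set along the compact circle, hence a closed set, and
there are finitely many index sets. -/
theorem measurableSet_le_intervalStat {N : ℕ} (τ γ : ℝ) :
    MeasurableSet {x : Fin N → Angle | γ ≤ (intervalStat τ x : ℝ)} := by
  classical
  have hset : {x : Fin N → Angle | γ ≤ (intervalStat τ x : ℝ)} =
      ⋃ S : {S : Finset (Fin N) // γ ≤ (S.card : ℝ)},
        {x | ∃ θ, ∀ i ∈ S.1, x i ∈ arc τ θ} := by
    ext x
    simp only [Set.mem_ofPred_eq, Set.mem_iUnion, le_intervalStat_iff]
    constructor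
    · rintro ⟨θ, hθ⟩
      exact ⟨⟨_, hθ⟩, θ, fun i hi => (Finset.mem_filter.1 hi).2⟩
    · rintro ⟨⟨S, hS⟩, θ, hθ⟩
      refine ⟨θ, hS.trans ?_⟩
      exact_mod_cast Finset.card_le_card fun i hi =>
        Finset.mem_filter.2 ⟨Finset.mem_univ i, hθ i hi⟩
  rw [hset]
  refine MeasurableSet.iUnion fun S => IsClosed.measurableSet ?_
  have hcl : IsClosed {p : Angle × (Fin N → Angle) | ∀ i ∈ S.1, p.2 i ∈ arc τ p.1} := by
    simp only [Set.ofPred_forall]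
    refine isClosed_iInter fun i => isClosed_iInter fun _ => ?_
    exact (isClosed_arc_rel τ).preimage (f := fun p : Angle × (Fin N → Angle) => (p.2 i, p.1))
      (by fun_prop)
  convert isClosedMap_snd_of_compactSpace _ hcl using 1
  ext x
  simp

theorem measurable_intervalTest {N : ℕ} (τ γ : ℝ) :
    Measurable (intervalTest τ γ : (Fin N → Angle) → Bool) := by
  classical
  refine measurable_to_bool ?_
  convert measurableSet_le_intervalStat (N := N) τ γ using 1
  ext x
  simp [intervalTest]

/-- If an arc contains many points, then so does an arc that starts at one of them. -/
theorem exists_sub_one_le_hits {n : ℕ} {τ γ : ℝ} (hγ : 0 < γ) {x : Fin (n + 1) → Angle}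
    (h : γ ≤ (intervalStat τ x : ℝ)) :
    ∃ i : Fin (n + 1),
      γ - 1 ≤ (hits Finset.univ (arc τ (x i)) fun j => x (i.succAbove j) : ℝ) := by
  classical
  obtain ⟨θ, hθ⟩ := le_intervalStat_iff.1 h
  unfold hits at hθ
  set S := Finset.univ.filter fun i => x i ∈ arc τ θ with hS
  have hmem : ∀ i ∈ S, ∃ t ∈ Set.Icc 0 (2 * Real.pi * τ), θ + (t : Angle) = x i := fun i hi =>
    mem_arc_iff.1 (Finset.mem_filter.1 hi).2
  choose! t ht htx using hmem
  have hne : S.Nonempty := by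
    rw [← Finset.card_pos]
    exact_mod_cast hγ.trans_le hθ
  -- The point of smallest offset becomes the new start; all other offsets stay in the window after
  -- subtracting it. It is not counted among the others, whence `γ - 1`.
  obtain ⟨i, hi, hmin⟩ := S.exists_min_image t hne
  refine ⟨i, ?_⟩
  have hsub : S ⊆ insert i ((Finset.univ.filter fun j => x (i.succAbove j) ∈ arc τ (x i)).image
      i.succAbove) := by
    intro j hj
    rcases eq_or_ne j i with rfl | hji
    · exact Finset.mem_insert_self _ _
    · obtain ⟨k, rfl⟩ := Fin.exists_succAbove_eq hji
      refine Finset.mem_insert_of_mem (Finset.mem_image_of_mem _ (Finset.mem_filter.2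
        ⟨Finset.mem_univ _, mem_arc_iff.2 ⟨t (i.succAbove k) - t i, ⟨?_, ?_⟩, ?_⟩⟩))
      · linarith [hmin _ hj]
      · linarith [(ht _ hj).2, (ht _ hi).1]
      · rw [← htx _ hi, ← htx _ hj, AddCircle.coe_sub]
        abel
  have hcard := (Finset.card_le_card hsub).trans ((Finset.card_insert_le _ _).trans
    (Nat.add_le_add_right Finset.card_image_le 1))
  have hcard' : (S.card : ℝ) ≤
      (hits Finset.univ (arc τ (x i)) fun j => x (i.succAbove j) : ℝ) + 1 := by
    exact_mod_cast hcard
  linarith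

/-- Union bound over the `n + 1` possible starting points. Splitting off coordinate `i` leaves `n`
independent uniform points and an arc that is fixed once `x i` is fixed, so Fubini applies. -/
theorem nullLaw_le_intervalStat_le {n : ℕ} {τ γ : ℝ} (hγ : 0 < γ) {b : ℝ≥0∞}
    (hb : ∀ θ, (Measure.pi fun _ : Fin n => unifCircle)
      {y | γ - 1 ≤ (hits Finset.univ (arc τ θ) y : ℝ)} ≤ b) :
    nullLaw (n + 1) {x | γ ≤ (intervalStat τ x : ℝ)} ≤ (n + 1 : ℕ) * b := by
  have hE : MeasurableSet {p : Angle × (Fin n → Angle) |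
      γ - 1 ≤ (hits Finset.univ (arc τ p.1) p.2 : ℝ)} :=
    measurableSet_le measurable_const
      ((measurable_from_top (f := fun n : ℕ => (n : ℝ))).comp
        (measurable_hits_rel _ (isClosed_arc_rel τ).measurableSet))
  have hsub : {x : Fin (n + 1) → Angle | γ ≤ (intervalStat τ x : ℝ)} ⊆
      ⋃ i ∈ (Finset.univ : Finset (Fin (n + 1))),
        (MeasurableEquiv.piFinSuccAbove (fun _ => Angle) i) ⁻¹' {p : Angle × (Fin n → Angle) |
        γ - 1 ≤ (hits Finset.univ (arc τ p.1) p.2 : ℝ)} := by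
    intro x hx
    obtain ⟨i, hi⟩ := exists_sub_one_le_hits hγ hx
    simp only [Set.mem_iUnion]
    exact ⟨i, Finset.mem_univ i, hi⟩
  refine (measure_mono hsub).trans ((measure_biUnion_finset_le _ _).trans ?_)
  refine (Finset.sum_le_card_nsmul _ _ b fun i _ => ?_).trans_eq (by simp)
  rw [nullLaw,
    (measurePreserving_piFinSuccAbove (fun _ : Fin (n + 1) => unifCircle) i).measure_preimage
      hE.nullMeasurableSet,
    Measure.prod_apply hE]
  refine (lintegral_mono fun θ => hb θ).trans ?_
  simp

/-! ### Densities and the likelihood ratio -/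

theorem isProbabilityMeasure_unifArc {τ : ℝ} (h0 : 0 < τ) (h1 : τ < 1) (θ : Angle) :
    IsProbabilityMeasure (unifArc τ θ) :=
  cond_isProbabilityMeasure (by rw [unifCircle_arc h1]; simpa using h0)

theorem isProbabilityMeasure_ite_unifArc {τ : ℝ} (h0 : 0 < τ) (h1 : τ < 1) (θ : Angle) (P : Prop)
    [Decidable P] : IsProbabilityMeasure (if P then unifArc τ θ else unifCircle) := by
  have := isProbabilityMeasure_unifArc h0 h1 θ
  split_ifs <;> infer_instance

/-- The density of `unifArc τ θ` with respect to `unifCircle`. -/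
noncomputable def arcDensity (τ : ℝ) (θ a : Angle) : ℝ≥0∞ :=
  (arc τ θ).indicator (fun _ => (ENNReal.ofReal τ)⁻¹) a

theorem measurable_arcDensity_uncurry (τ : ℝ) :
    Measurable fun p : Angle × Angle => arcDensity τ p.1 p.2 := by
  have : (fun p : Angle × Angle => arcDensity τ p.1 p.2) =
      {p : Angle × Angle | p.2 ∈ arc τ p.1}.indicator fun _ => (ENNReal.ofReal τ)⁻¹ := by
    ext p
    simp [arcDensity, Set.indicator]
  rw [this]
  exact measurable_const.indicator
    ((isClosed_arc_rel τ).measurableSet.preimage (f := fun p : Angle × Angle => (p.2, p.1))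
      (by fun_prop))

theorem measurable_arcDensity (τ : ℝ) (θ : Angle) : Measurable (arcDensity τ θ) :=
  measurable_const.indicator (measurableSet_arc τ θ)

theorem unifArc_eq_withDensity {τ : ℝ} (h1 : τ < 1) (θ : Angle) :
    unifArc τ θ = unifCircle.withDensity (arcDensity τ θ) := by
  ext s hs
  rw [unifArc, ProbabilityTheory.cond_apply (measurableSet_arc τ θ), withDensity_apply _ hs,
    unifCircle_arc h1]
  simp only [arcDensity]
  rw [setLIntegral_indicator (measurableSet_arc τ θ), lintegral_const, Measure.restrict_apply_univ]

theorem lintegral_arcDensity {τ : ℝ} (h0 : 0 < τ) (h1 : τ < 1) (θ : Angle) :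
    ∫⁻ a, arcDensity τ θ a ∂unifCircle = 1 := by
  have := isProbabilityMeasure_unifArc h0 h1 θ
  rw [← setLIntegral_univ, ← withDensity_apply _ MeasurableSet.univ,
    ← unifArc_eq_withDensity h1, measure_univ]

theorem measurable_prod_arcDensity {N : ℕ} (τ : ℝ) (S : Finset (Fin N)) :
    Measurable fun p : Angle × (Fin N → Angle) => ∏ i ∈ S, arcDensity τ p.1 (p.2 i) :=
  Finset.measurable_prod _ fun i _ => (measurable_arcDensity_uncurry τ).comp
    (g := fun p : Angle × Angle => arcDensity τ p.1 p.2)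
    (f := fun p : Angle × (Fin N → Angle) => (p.1, p.2 i)) (by fun_prop)

theorem condLaw_eq_withDensity {N : ℕ} {τ : ℝ} (h0 : 0 < τ) (h1 : τ < 1) (S : Finset (Fin N))
    (θ : Angle) :
    condLaw N τ S θ = (nullLaw N).withDensity fun x => ∏ i ∈ S, arcDensity τ θ (x i) := by
  have := fun i => isProbabilityMeasure_ite_unifArc h0 h1 θ (i ∈ S)
  refine Measure.pi_eq fun s hs => ?_
  have hpi : MeasurableSet (Set.univ.pi s) := MeasurableSet.univ_pi hs
  let f : Fin N → Angle → ℝ≥0∞ := fun i =>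
    (s i).indicator fun a => if i ∈ S then arcDensity τ θ a else 1
  have hf : ∀ i, Measurable (f i) := fun i =>
    Measurable.indicator (by split_ifs; exacts [measurable_arcDensity τ θ, measurable_const]) (hs i)
  have hprod : ((Set.univ.pi s).indicator fun x => ∏ i ∈ S, arcDensity τ θ (x i)) =
      fun x => ∏ i, f i (x i) := by
    ext x
    by_cases hx : x ∈ Set.univ.pi s
    · rw [Set.indicator_of_mem hx]
      have : ∀ i, f i (x i) = if i ∈ S then arcDensity τ θ (x i) else 1 := fun i =>
        Set.indicator_of_mem (hx i trivial) _
      simp_rw [this]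
      rw [Finset.prod_ite_mem, Finset.univ_inter]
    · rw [Set.indicator_of_notMem hx]
      obtain ⟨i, hi⟩ : ∃ i, x i ∉ s i := by simpa [Set.mem_pi] using hx
      exact (Finset.prod_eq_zero (Finset.mem_univ i) (Set.indicator_of_notMem hi _)).symm
  rw [withDensity_apply _ hpi, ← lintegral_indicator hpi, hprod, nullLaw,
    lintegral_pi_prod _ _ hf]
  refine Finset.prod_congr rfl fun i _ => ?_
  simp only [f]
  rw [lintegral_indicator (hs i)]
  split_ifs
  · rw [unifArc_eq_withDensity h1, withDensity_apply _ (hs i)]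
  · simp

/-- Needed to evaluate `Measure.bind` as an average over the phase. -/
theorem measurable_condLaw {N : ℕ} {τ : ℝ} (h0 : 0 < τ) (h1 : τ < 1) (S : Finset (Fin N)) :
    Measurable fun θ => condLaw N τ S θ := by
  refine Measure.measurable_of_measurable_coe _ fun s hs => ?_
  simp_rw [condLaw_eq_withDensity h0 h1, withDensity_apply _ hs]
  exact Measurable.lintegral_prod_right' (ν := (nullLaw N).restrict s)
    (measurable_prod_arcDensity τ S)

/-- The likelihood ratio of the planted law with respect to the null law. -/
noncomputable def likelihoodRatio (N K : ℕ) (τ : ℝ) (x : Fin N → Angle) : ℝ≥0∞ :=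
  (N.choose K : ℝ≥0∞)⁻¹ * ∑ S ∈ (Finset.univ : Finset (Fin N)).powersetCard K,
    ∫⁻ θ, ∏ i ∈ S, arcDensity τ θ (x i) ∂unifCircle

theorem measurable_lintegral_prod_arcDensity {N : ℕ} (τ : ℝ) (S : Finset (Fin N)) :
    Measurable fun x : Fin N → Angle => ∫⁻ θ, ∏ i ∈ S, arcDensity τ θ (x i) ∂unifCircle :=
  Measurable.lintegral_prod_left' (μ := unifCircle) (measurable_prod_arcDensity τ S)

theorem measurable_likelihoodRatio (N K : ℕ) (τ : ℝ) : Measurable (likelihoodRatio N K τ) :=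
  (Finset.measurable_sum _ fun S _ => measurable_lintegral_prod_arcDensity τ S).const_mul _

theorem plantedLaw_eq_withDensity {N K : ℕ} {τ : ℝ} (h0 : 0 < τ) (h1 : τ < 1) :
    plantedLaw N K τ = (nullLaw N).withDensity (likelihoodRatio N K τ) := by
  ext s hs
  rw [withDensity_apply _ hs]
  simp only [likelihoodRatio]
  rw [lintegral_const_mul _
      (Finset.measurable_sum _ fun S _ => measurable_lintegral_prod_arcDensity τ S),
    lintegral_finsetSum _ fun S _ => measurable_lintegral_prod_arcDensity τ S,
    plantedLaw, Measure.smul_apply, Measure.finsetSum_apply, Finset.card_powersetCard,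
    Finset.card_fin, smul_eq_mul]
  congr 1
  refine Finset.sum_congr rfl fun S _ => ?_
  rw [Measure.bind_apply hs (measurable_condLaw h0 h1 S).aemeasurable]
  simp_rw [condLaw_eq_withDensity h0 h1, withDensity_apply _ hs]
  exact lintegral_lintegral_swap (measurable_prod_arcDensity τ S).aemeasurable

theorem plantedLaw_le {N K : ℕ} {τ : ℝ} {s : Set (Fin N → Angle)} (hs : MeasurableSet s)
    {b : ℝ≥0∞} (hb : ∀ S : Finset (Fin N), S.card = K → ∀ θ, condLaw N τ S θ s ≤ b) :
    plantedLaw N K τ s ≤ b := by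
  rw [plantedLaw, Measure.smul_apply, Measure.finsetSum_apply, smul_eq_mul]
  refine (mul_le_mul_right (Finset.sum_le_card_nsmul _ _ b fun S hS => ?_) _).trans ?_
  · refine (Measure.bind_apply_le _ hs).trans ?_
    refine (lintegral_mono fun θ => hb S (Finset.mem_powersetCard.1 hS).2 θ).trans ?_
    simp
  · rw [nsmul_eq_mul, ← mul_assoc]
    exact mul_le_of_le_one_left' (ENNReal.inv_mul_le_one _)

theorem isProbabilityMeasure_plantedLaw {N K : ℕ} {τ : ℝ} (h0 : 0 < τ) (h1 : τ < 1)
    (hK : K ≤ N) : IsProbabilityMeasure (plantedLaw N K τ) := by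
  constructor
  rw [plantedLaw, Measure.smul_apply, Measure.finsetSum_apply]
  have : ∀ S : Finset (Fin N), (unifCircle.bind fun θ => condLaw N τ S θ) Set.univ = 1 := by
    intro S
    rw [Measure.bind_apply MeasurableSet.univ (measurable_condLaw h0 h1 S).aemeasurable]
    have h : ∀ θ, condLaw N τ S θ Set.univ = 1 := fun θ => by
      have := fun i => isProbabilityMeasure_ite_unifArc h0 h1 θ (i ∈ S)
      exact measure_univ (μ := Measure.pi _)
    simp [h]
  simp_rw [this, Finset.sum_const, smul_eq_mul, nsmul_eq_mul, mul_one]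
  refine ENNReal.inv_mul_cancel ?_ (ENNReal.natCast_ne_top _)
  rw [Finset.card_powersetCard, Finset.card_fin]
  exact_mod_cast (Nat.choose_pos hK).ne'

/-! ### Counts in the planted arc -/

theorem ae_condLaw_mem_arc {N : ℕ} {τ : ℝ} (h0 : 0 < τ) (h1 : τ < 1) (S : Finset (Fin N))
    (θ : Angle) : ∀ᵐ x ∂condLaw N τ S θ, ∀ i ∈ S, x i ∈ arc τ θ := by
  have := fun i => isProbabilityMeasure_ite_unifArc h0 h1 θ (i ∈ S)
  refine ae_all_iff.2 fun i => ?_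
  by_cases hi : i ∈ S
  · have h : ∀ᵐ a ∂(if i ∈ S then unifArc τ θ else unifCircle), a ∈ arc τ θ := by
      rw [if_pos hi]
      exact ae_cond_mem (measurableSet_arc τ θ)
    filter_upwards [(measurePreserving_eval (fun i => if i ∈ S then unifArc τ θ else unifCircle)
      i).quasiMeasurePreserving.ae h] with x hx _ using hx
  · exact ae_of_all _ fun x h => absurd h hi

theorem condLaw_intervalStat_lt_le {N : ℕ} {τ : ℝ} (h0 : 0 < τ) (h1 : τ < 1)
    (S : Finset (Fin N)) (θ : Angle) (γ : ℝ) :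
    condLaw N τ S θ {x | (intervalStat τ x : ℝ) < γ} ≤
      condLaw N τ S θ {x | S.card + (hits Sᶜ (arc τ θ) x : ℝ) < γ} := by
  classical
  refine measure_mono_ae ?_
  filter_upwards [ae_condLaw_mem_arc h0 h1 S θ] with x hx hlt
  have hall : S.card + hits Sᶜ (arc τ θ) x ≤ hits Finset.univ (arc τ θ) x := by
    unfold hits
    rw [← Finset.card_union_of_disjoint]
    · refine Finset.card_le_card fun i hi => Finset.mem_filter.2 ⟨Finset.mem_univ i, ?_⟩
      rcases Finset.mem_union.1 hi with h | h
      · exact hx i h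
      · exact (Finset.mem_filter.1 h).2
    · exact Finset.disjoint_left.2 fun i hi h =>
        (Finset.mem_compl.1 (Finset.mem_filter.1 h).1) hi
  have hstat : (hits Finset.univ (arc τ θ) x : ℝ) ≤ intervalStat τ x :=
    le_intervalStat_iff.2 ⟨θ, le_rfl⟩
  have hall' : (S.card + hits Sᶜ (arc τ θ) x : ℝ) ≤ hits Finset.univ (arc τ θ) x := by
    exact_mod_cast hall
  exact hall'.trans_lt (hstat.trans_lt hlt)

/-- Chernoff bound for the lower tail of the number of unplanted points in the planted arc. -/
theorem condLaw_hits_compl_lt_le {N : ℕ} {τ : ℝ} (h0 : 0 < τ) (h1 : τ < 1) (S : Finset (Fin N))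
    (θ : Angle) {M c : ℝ} (hM : (Sᶜ.card : ℝ) * τ = M) (hM0 : 0 < M) :
    condLaw N τ S θ {x | (hits Sᶜ (arc τ θ) x : ℝ) < M - c * √M} ≤
      ENNReal.ofReal (Real.exp (1 / 2 - c)) := by
  have := fun i => isProbabilityMeasure_ite_unifArc h0 h1 θ (i ∈ S)
  have hq : 0 < √M := Real.sqrt_pos.2 hM0
  have hsq : √M * √M = M := Real.mul_self_sqrt hM0.le
  -- The tilt `y = exp(-s)` with `s = 1/√M` turns the second-order term `M s² / 2` into the constant
  -- 1/2 and the deviation term into `-c`.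
  set s := (√M)⁻¹ with hs
  have hs0 : 0 < s := inv_pos.2 hq
  have hp : ∀ i ∈ Sᶜ, (if i ∈ S then unifArc τ θ else unifCircle) (arc τ θ) =
      ENNReal.ofReal τ := fun i hi => by
    rw [if_neg (Finset.mem_compl.1 hi), unifCircle_arc h1]
  have hch := pi_rpow_le_hits_le (fun i => if i ∈ S then unifArc τ θ else unifCircle) Sᶜ
    (measurableSet_arc τ θ) h0.le hp (Real.exp_pos (-s)) (M - c * √M)
  refine (measure_mono fun x hx => ?_).trans (hch.trans (ENNReal.ofReal_le_ofReal ?_))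
  · exact Real.rpow_le_rpow_of_exponent_ge (Real.exp_pos _)
      (Real.exp_le_one_iff.2 (by linarith)) (le_of_lt hx)
  · rw [Real.exp_le_exp, Real.log_exp, hM]
    -- Follows from `exp s ≥ 1 + s + s²/2` and `(1 + s²/2)² - s² = 1 + s⁴/4 ≥ 1`.
    have hexp : Real.exp (-s) ≤ 1 - s + s ^ 2 / 2 := by
      rw [Real.exp_neg, inv_le_comm₀ (Real.exp_pos _) (by nlinarith [sq_nonneg (s - 1)])]
      refine le_trans ?_ (Real.quadratic_le_exp_of_nonneg hs0.le)
      rw [inv_le_iff_one_le_mul₀ (by nlinarith [sq_nonneg (s - 1)])]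
      nlinarith [sq_nonneg (s ^ 2)]
    have h1 : M * s ^ 2 = 1 := by
      rw [hs, inv_pow, Real.sq_sqrt hM0.le, mul_inv_cancel₀ hM0.ne']
    have h2 : √M * s = 1 := mul_inv_cancel₀ hq.ne'
    calc M * (Real.exp (-s) - 1) - (M - c * √M) * -s
        ≤ M * (-s + s ^ 2 / 2) - (M - c * √M) * -s := by gcongr; linarith
      _ = M * s ^ 2 / 2 - c * (√M * s) := by ring
      _ = 1 / 2 - c := by rw [h1, h2, mul_one]

/-! ### Error probabilities of the interval test -/

theorem pFalseAlarm_intervalTest {N : ℕ} (τ γ : ℝ) :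
    pFalseAlarm (intervalTest (N := N) τ γ) =
      (nullLaw N).real {x | γ ≤ (intervalStat τ x : ℝ)} := by
  simp [pFalseAlarm, intervalTest]

theorem pMiss_intervalTest {N : ℕ} (K : ℕ) (τ γ : ℝ) :
    pMiss K τ (intervalTest (N := N) τ γ) =
      (plantedLaw N K τ).real {x | (intervalStat τ x : ℝ) < γ} := by
  simp [pMiss, intervalTest]

theorem measurableSet_intervalStat_lt {N : ℕ} (τ γ : ℝ) :
    MeasurableSet {x : Fin N → Angle | (intervalStat τ x : ℝ) < γ} := by
  convert (measurableSet_le_intervalStat τ γ).compl using 1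
  ext x
  simp

theorem pFalseAlarm_intervalTest_natCast_le {N K : ℕ} {τ : ℝ} (hN : 1 ≤ N) (hK : 1 ≤ K)
    (h0 : 0 < τ) (h1 : τ < 1) :
    pFalseAlarm (intervalTest (N := N) τ K) ≤
      (N : ℝ) ^ K * τ ^ (K - 1) / ((K - 1).factorial : ℝ) := by
  obtain ⟨n, rfl⟩ := Nat.exists_eq_add_of_le' hN
  obtain ⟨k, rfl⟩ := Nat.exists_eq_add_of_le' hK
  have hb := nullLaw_le_intervalStat_le (n := n) (τ := τ) (γ := (k + 1 : ℕ)) (by positivity)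
    (b := ENNReal.ofReal (n.choose k * τ ^ k)) fun θ => by
      have h := pi_le_hits_le (ι := Fin n) unifCircle (arc τ θ) k
      rw [unifCircle_arc h1, Fintype.card_fin, ← ENNReal.ofReal_pow h0.le,
        ← ENNReal.ofReal_natCast, ← ENNReal.ofReal_mul (by positivity)] at h
      refine (measure_mono fun y hy => ?_).trans h
      have hy' : ((k + 1 : ℕ) : ℝ) - 1 ≤ hits Finset.univ (arc τ θ) y := hy
      rw [Nat.cast_add_one, add_sub_cancel_right] at hy'
      exact_mod_cast hy'
  rw [← ENNReal.ofReal_natCast, ← ENNReal.ofReal_mul (by positivity)] at hb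
  rw [pFalseAlarm_intervalTest]
  refine (ENNReal.toReal_le_of_le_ofReal (by positivity) hb).trans ?_
  have hc : (n.choose k : ℝ) ≤ (n + 1 : ℕ) ^ k / (k.factorial : ℝ) :=
    (Nat.choose_le_pow_div k n).trans (by gcongr; simp)
  rw [Nat.add_sub_cancel, pow_succ']
  calc ((n + 1 : ℕ) : ℝ) * (n.choose k * τ ^ k)
      ≤ ((n + 1 : ℕ) : ℝ) * ((n + 1 : ℕ) ^ k / (k.factorial : ℝ) * τ ^ k) := by gcongr
    _ = _ := by ring

theorem pFalseAlarm_intervalTest_le {n : ℕ} {τ γ t : ℝ} (hn : 1 ≤ n)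
    (h0 : 0 < τ) (h1 : τ < 1) (ht : 0 ≤ t) (hγ : γ = 1 + n * τ + t) :
    pFalseAlarm (intervalTest (N := n + 1) τ γ) ≤
      (n + 1) * Real.exp (-(t ^ 2 / (2 * (n * τ) + t))) := by
  have hμ : 0 < n * τ := by positivity
  set μ := n * τ with hμd
  have hu : 0 ≤ t / μ := by positivity
  have hb := nullLaw_le_intervalStat_le (n := n) (τ := τ) (γ := γ) (by linarith)
    (b := ENNReal.ofReal (Real.exp (-(t ^ 2 / (2 * μ + t))))) fun θ => by
      have h := pi_rpow_le_hits_le (fun _ : Fin n => unifCircle) Finset.univ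
        (measurableSet_arc τ θ) h0.le (fun i _ => unifCircle_arc h1 θ)
        (y := 1 + t / μ) (by linarith) (μ + t)
      refine (measure_mono fun y hy => ?_).trans (h.trans (ENNReal.ofReal_le_ofReal ?_))
      · refine Real.rpow_le_rpow_of_exponent_le (by linarith) ?_
        have hy' : γ - 1 ≤ hits Finset.univ (arc τ θ) y := hy
        linarith
      · rw [Real.exp_le_exp, Finset.card_fin, ← hμd, add_sub_cancel_left,
          mul_div_cancel₀ _ hμ.ne']
        -- The tilt `1 + t/μ` optimizes the Chernoff exponent `t - (μ + t) log(1 + t/μ)`; the bound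
        -- `log(1 + u) ≥ 2u/(u + 2)` gives the Bernstein form `-t²/(2μ + t)`.
        have hlog := mul_le_mul_of_nonneg_left (Real.le_log_one_add_of_nonneg hu)
          (by linarith : 0 ≤ μ + t)
        have : (μ + t) * (2 * (t / μ) / (t / μ + 2)) = t + t ^ 2 / (2 * μ + t) := by
          field_simp
          ring
        linarith
  rw [← ENNReal.ofReal_natCast, ← ENNReal.ofReal_mul (by positivity)] at hb
  rw [pFalseAlarm_intervalTest]
  refine (ENNReal.toReal_le_of_le_ofReal (by positivity) hb).trans_eq ?_
  push_cast
  rfl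

theorem pMiss_intervalTest_natCast {N K : ℕ} {τ : ℝ} (h0 : 0 < τ) (h1 : τ < 1) :
    pMiss K τ (intervalTest (N := N) τ K) = 0 := by
  have h : plantedLaw N K τ {x | (intervalStat τ x : ℝ) < K} ≤ 0 := by
    refine plantedLaw_le (measurableSet_intervalStat_lt τ K) fun S hS θ => ?_
    refine (condLaw_intervalStat_lt_le h0 h1 S θ K).trans_eq ?_
    have : {x | S.card + (hits Sᶜ (arc τ θ) x : ℝ) < K} = ∅ := by
      ext x
      simp [hS]
    rw [this, measure_empty]
  rw [pMiss_intervalTest, measureReal_def, le_antisymm h bot_le]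
  rfl

theorem pMiss_intervalTest_le {N K : ℕ} {τ c : ℝ} (h0 : 0 < τ) (h1 : τ < 1) (hK : K < N) :
    pMiss K τ (intervalTest (N := N) τ (((N : ℝ) - K) * τ + K - c * √(((N : ℝ) - K) * τ))) ≤
      Real.exp (1 / 2 - c) := by
  rw [pMiss_intervalTest]
  refine ENNReal.toReal_le_of_le_ofReal (Real.exp_pos _).le ?_
  refine plantedLaw_le (measurableSet_intervalStat_lt τ _) fun S hS θ => ?_
  refine (condLaw_intervalStat_lt_le h0 h1 S θ _).trans ?_
  have hKN : (0 : ℝ) < N - K := sub_pos.2 (by exact_mod_cast hK)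
  refine (measure_mono fun x hx => ?_).trans
    (condLaw_hits_compl_lt_le h0 h1 S θ (M := ((N : ℝ) - K) * τ) (c := c) ?_ (by positivity))
  · have hx' : S.card + (hits Sᶜ (arc τ θ) x : ℝ) <
        ((N : ℝ) - K) * τ + K - c * √(((N : ℝ) - K) * τ) := hx
    rw [hS] at hx'
    change (hits Sᶜ (arc τ θ) x : ℝ) < _
    linarith
  · rw [Finset.card_compl, Fintype.card_fin, hS, Nat.cast_sub hK.le]

theorem achievesStrongDetection_card {K : ℕ → ℕ} {τ : ℕ → ℝ}
    (hK : ∀ᶠ N in atTop, 1 ≤ K N ∧ K N ≤ N) (hτ : ∀ᶠ N in atTop, 0 < τ N ∧ τ N < 1)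
    (h : Tendsto (fun N : ℕ => (N : ℝ) ^ (K N) * (τ N) ^ (K N - 1) / ((K N - 1).factorial : ℝ))
      atTop (𝓝 0)) :
    AchievesStrongDetection K τ (fun N => intervalTest (τ N) (K N : ℝ)) := by
  refine ⟨fun N => measurable_intervalTest _ _, ?_, ?_⟩
  · refine squeeze_zero' (Eventually.of_forall fun N => measureReal_nonneg) ?_ h
    filter_upwards [hK, hτ] with N hKN hτN
    exact pFalseAlarm_intervalTest_natCast_le (hKN.1.trans hKN.2) hKN.1 hτN.1 hτN.2
  · refine tendsto_const_nhds.congr' ?_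
    filter_upwards [hτ] with N hτN
    exact (pMiss_intervalTest_natCast hτN.1 hτN.2).symm

/-- The false alarm bound has mean `(N - 1)τ` and excess `A - (1 - τ)`, whereas the hypothesis of
(A2) has `Nτ` and `A`. Passing from one to the other costs at most 2 in the exponent, since `A² - (A
- d)² ≤ 2A`. -/
theorem sq_div_sub_two_le {m A d τ : ℝ} (hm : 0 < m) (hd0 : 0 ≤ d) (hd1 : d ≤ 1) (hdA : d ≤ A)
    (hτ : 0 ≤ τ) :
    A ^ 2 / (2 * (m + τ) + A) - 2 ≤ (A - d) ^ 2 / (2 * m + (A - d)) := by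
  have hle : (A - d) ^ 2 / (2 * (m + τ) + A) ≤ (A - d) ^ 2 / (2 * m + (A - d)) := by
    gcongr
    · linarith
    · linarith
  refine le_trans ?_ hle
  rw [sub_le_iff_le_add, ← sub_le_iff_le_add', ← sub_div, div_le_iff₀ (by linarith)]
  nlinarith

theorem achievesStrongDetection_shifted {K : ℕ → ℕ} {τ : ℕ → ℝ}
    (hK : ∀ᶠ N in atTop, 1 ≤ K N ∧ K N ≤ N) (hτ : ∀ᶠ N in atTop, 0 < τ N ∧ τ N < 1)
    {c γ : ℕ → ℝ} (hc : Tendsto c atTop atTop)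
    (hγ : ∀ N : ℕ, γ N = ((N : ℝ) - K N) * τ N + K N - c N * √(((N : ℝ) - K N) * τ N))
    (hγ1 : ∀ᶠ N : ℕ in atTop, 1 + ((N : ℝ) - 1) * τ N ≤ γ N)
    (h1 : Tendsto (fun N : ℕ => ((K N : ℝ) - 1) ^ 2 * (1 - τ N) ^ 2 / (((N : ℝ) - K N) * τ N))
      atTop atTop)
    (h2 : Tendsto (fun N : ℕ =>
      ((K N : ℝ) * (1 - τ N) - c N * √(((N : ℝ) - K N) * τ N)) ^ 2 /
        (2 * N * τ N + K N * (1 - τ N) - c N * √(((N : ℝ) - K N) * τ N)) - Real.log N)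
      atTop atTop) :
    AchievesStrongDetection K τ (fun N => intervalTest (τ N) (γ N)) := by
  refine ⟨fun N => measurable_intervalTest _ _, ?_, ?_⟩
  · have hlim := Real.tendsto_exp_atBot.comp (tendsto_atBot_add_const_left _ 2
      (tendsto_neg_atTop_atBot.comp h2))
    refine squeeze_zero' (Eventually.of_forall fun N => measureReal_nonneg) ?_ hlim
    filter_upwards [hτ, hγ1, eventually_ge_atTop 2] with N hτN hγN hN
    obtain ⟨n, rfl⟩ := Nat.exists_eq_add_of_le' (one_le_two.trans hN)
    obtain ⟨ht0, ht1⟩ := hτN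
    have hn : 1 ≤ n := by omega
    have hγe := hγ (n + 1)
    simp only [Function.comp_apply]
    set q := c (n + 1) * √(((n + 1 : ℕ) - K (n + 1) : ℝ) * τ (n + 1)) with hq
    set κ := (K (n + 1) : ℝ)
    generalize γ (n + 1) = g at *
    generalize τ (n + 1) = t at *
    push_cast at *
    have hm : 0 < n * t := by positivity
    -- This is `γ ≥ 1 + (N - 1)τ` rewritten; it makes the excess over `1 + (N - 1)τ` nonnegative.
    have hA : 1 - t ≤ κ * (1 - t) - q := by nlinarith
    refine (pFalseAlarm_intervalTest_le (t := κ * (1 - t) - q - (1 - t)) hn ht0 ht1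
      (by linarith) (by rw [hγe]; ring)).trans ?_
    have hkey := sq_div_sub_two_le hm (by linarith : 0 ≤ 1 - t) (by linarith) hA ht0.le
    have hn1 : (0 : ℝ) < n + 1 := by positivity
    nth_rewrite 1 [← Real.exp_log hn1]
    rw [← Real.exp_add, Real.exp_le_exp]
    have : 2 * (n * t + t) + (κ * (1 - t) - q) = 2 * (n + 1) * t + κ * (1 - t) - q := by ring
    rw [this] at hkey
    linarith
  · have hlim := Real.tendsto_exp_atBot.comp (tendsto_atBot_add_const_left _ (1 / 2)
      (tendsto_neg_atTop_atBot.comp hc))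
    refine squeeze_zero' (Eventually.of_forall fun N => measureReal_nonneg) ?_ hlim
    filter_upwards [hK, hτ, h1.eventually_gt_atTop 0] with N hKN hτN h1N
    have hlt : K N < N := by
      -- If `K N = N`, the quotient in `h1` has denominator 0 and so equals 0, contradicting its
      -- positivity.
      refine lt_of_le_of_ne hKN.2 fun he => ?_
      rw [he] at h1N
      simp at h1N
    rw [hγ N]
    exact pMiss_intervalTest_le hτN.1 hτN.2 hlt

/-! ### Second moment method -/

/-- Integrate `2ε 1_A (L - 1) ≤ (L - 1)² + ε²`: the right side is at most `χ + ε² ≤ 2ε²`. The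
pointwise inequality `hpt` is the same one with all terms moved so that no subtraction occurs in
`ℝ≥0∞`. -/
theorem real_le_real_add_of_lintegral_sq_le {Ω : Type*} [MeasurableSpace Ω] {Q : Measure Ω}
    [IsProbabilityMeasure Q] {L : Ω → ℝ≥0∞} (hL : Measurable L)
    [hP : IsProbabilityMeasure (Q.withDensity L)] {χ ε : ℝ} (hχ0 : 0 ≤ χ) (hε : 0 < ε)
    (hχ : χ ≤ ε ^ 2) (h : ∫⁻ ω, L ω ^ 2 ∂Q ≤ ENNReal.ofReal (1 + χ)) {A : Set Ω}
    (hA : MeasurableSet A) : (Q.withDensity L).real A ≤ Q.real A + ε := by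
  have h1 : ∫⁻ ω, L ω ∂Q = 1 := by
    rw [← setLIntegral_univ, ← withDensity_apply _ MeasurableSet.univ, measure_univ]
  have hpt : ∀ ω, ENNReal.ofReal (2 * ε) * A.indicator L ω + 2 * L ω ≤
      ENNReal.ofReal (2 * ε) * A.indicator 1 ω + (L ω ^ 2 + ENNReal.ofReal (1 + ε ^ 2)) := by
    intro ω
    rcases eq_or_ne (L ω) ∞ with htop | htop
    · simp [htop]
    · obtain ⟨l, hl0, hl⟩ : ∃ l : ℝ, 0 ≤ l ∧ L ω = ENNReal.ofReal l :=
        ⟨(L ω).toReal, ENNReal.toReal_nonneg, (ENNReal.ofReal_toReal htop).symm⟩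
      have h2 : (2 : ℝ≥0∞) = ENNReal.ofReal 2 := by simp
      by_cases hω : ω ∈ A
      · rw [Set.indicator_of_mem hω, Set.indicator_of_mem hω, hl, h2, Pi.one_apply, mul_one,
          ← ENNReal.ofReal_pow hl0, ← ENNReal.ofReal_mul (by positivity),
          ← ENNReal.ofReal_mul (by positivity),
          ← ENNReal.ofReal_add (by positivity) (by positivity),
          ← ENNReal.ofReal_add (by positivity) (by positivity),
          ← ENNReal.ofReal_add (by positivity) (by positivity)]
        exact ENNReal.ofReal_le_ofReal (by nlinarith [sq_nonneg (l - 1 - ε)])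
      · rw [Set.indicator_of_notMem hω, Set.indicator_of_notMem hω, hl, h2, mul_zero, zero_add,
          zero_add, ← ENNReal.ofReal_pow hl0, ← ENNReal.ofReal_mul (by positivity),
          ← ENNReal.ofReal_add (by positivity) (by positivity)]
        exact ENNReal.ofReal_le_ofReal (by nlinarith [sq_nonneg (l - 1), sq_nonneg ε])
  have hint := lintegral_mono (μ := Q) hpt
  rw [lintegral_add_left ((hL.indicator hA).const_mul _),
    lintegral_const_mul _ (hL.indicator hA), lintegral_indicator hA, ← withDensity_apply _ hA,
    lintegral_const_mul _ hL, h1,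
    lintegral_add_left ((measurable_one.indicator hA).const_mul _),
    lintegral_const_mul _ (measurable_one.indicator hA), lintegral_indicator_one hA,
    lintegral_add_left (hL.pow_const 2), lintegral_const, measure_univ, mul_one, mul_one] at hint
  have hint' := hint.trans (add_le_add_right (add_le_add_left h _) _)
  have hfin := ENNReal.toReal_mono (by finiteness) hint'
  rw [ENNReal.toReal_add (by finiteness) (by finiteness), ENNReal.toReal_mul,
    ENNReal.toReal_add (by finiteness) (by finiteness), ENNReal.toReal_mul,
    ENNReal.toReal_add (by finiteness) (by finiteness), ENNReal.toReal_ofReal (by positivity),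
    ENNReal.toReal_ofReal (by positivity), ENNReal.toReal_ofReal (by positivity),
    ENNReal.toReal_ofNat] at hfin
  simp only [measureReal_def]
  refine le_of_mul_le_mul_left ?_ (by positivity : 0 < 2 * ε)
  linarith

theorem lintegral_arcDensity_mul (τ : ℝ) (θ θ' : Angle) :
    ∫⁻ a, arcDensity τ θ a * arcDensity τ θ' a ∂unifCircle =
      (ENNReal.ofReal τ)⁻¹ ^ 2 * unifCircle (arc τ θ ∩ arc τ θ') := by
  have : ∀ a, arcDensity τ θ a * arcDensity τ θ' a =
      (arc τ θ ∩ arc τ θ').indicator (fun _ => (ENNReal.ofReal τ)⁻¹ ^ 2) a := by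
    intro a
    rw [pow_two, Set.inter_indicator_mul]
    rfl
  simp_rw [this]
  rw [lintegral_indicator ((measurableSet_arc τ θ).inter (measurableSet_arc τ θ')),
    lintegral_const, Measure.restrict_apply_univ]

theorem unifCircle_arc_inter_add (τ : ℝ) (θ δ : Angle) :
    unifCircle (arc τ θ ∩ arc τ (θ + δ)) = unifCircle (arc τ 0 ∩ arc τ δ) := by
  rw [← measure_preimage_add unifCircle (-θ) (arc τ 0 ∩ arc τ δ), Set.preimage_inter,
    ← preimage_arc]
  congr 2
  ext x
  rw [Set.mem_preimage, mem_arc_iff_sub_mem, mem_arc_iff_sub_mem (θ := δ)]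
  congr! 1
  abel

/-- Coordinates are independent under the null law; an index in at most one of the sets integrates
to 1, and one in both gives the normalized overlap. -/
theorem lintegral_prod_arcDensity_mul {N : ℕ} {τ : ℝ} (h0 : 0 < τ) (h1 : τ < 1)
    (S S' : Finset (Fin N)) (θ θ' : Angle) :
    ∫⁻ x, (∏ i ∈ S, arcDensity τ θ (x i)) * ∏ i ∈ S', arcDensity τ θ' (x i) ∂nullLaw N =
      ((ENNReal.ofReal τ)⁻¹ ^ 2 * unifCircle (arc τ θ ∩ arc τ θ')) ^ (S ∩ S').card := by
  let f : Fin N → Angle → ℝ≥0∞ := fun i a =>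
    (if i ∈ S then arcDensity τ θ a else 1) * (if i ∈ S' then arcDensity τ θ' a else 1)
  have hite : ∀ (P : Prop) [Decidable P] (η : Angle),
      Measurable fun a => if P then arcDensity τ η a else 1 := fun P _ η => by
    split_ifs
    exacts [measurable_arcDensity τ η, measurable_const]
  have hf : ∀ i, Measurable (f i) := fun i => (hite _ θ).mul (hite _ θ')
  have hprod : ∀ x : Fin N → Angle, (∏ i ∈ S, arcDensity τ θ (x i)) *
      ∏ i ∈ S', arcDensity τ θ' (x i) = ∏ i, f i (x i) := by
    intro x
    rw [Finset.prod_mul_distrib, Finset.prod_ite_mem, Finset.prod_ite_mem, Finset.univ_inter,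
      Finset.univ_inter]
  simp_rw [hprod]
  rw [nullLaw, lintegral_pi_prod _ _ hf, ← Finset.prod_const, ← Finset.univ_inter (S ∩ S'),
    ← Finset.prod_ite_mem]
  refine Finset.prod_congr rfl fun i _ => ?_
  by_cases hS : i ∈ S <;> by_cases hS' : i ∈ S' <;>
    simp [f, hS, hS', lintegral_arcDensity h0 h1, lintegral_arcDensity_mul]

theorem lintegral_mul_lintegral_prod_arcDensity_le {N : ℕ} {τ : ℝ} (h0 : 0 < τ) (h1 : τ ≤ 1 / 2)
    (S S' : Finset (Fin N)) :
    ∫⁻ x, (∫⁻ θ, ∏ i ∈ S, arcDensity τ θ (x i) ∂unifCircle) *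
        ∫⁻ θ, ∏ i ∈ S', arcDensity τ θ (x i) ∂unifCircle ∂nullLaw N ≤
      ENNReal.ofReal (1 + 2 * τ * ((1 / τ) ^ (S ∩ S').card / ((S ∩ S').card + 1))) := by
  have hlt : τ < 1 := by linarith
  set h := (S ∩ S').card with hh
  have hm := fun (S : Finset (Fin N)) => measurable_prod_arcDensity τ S
  have hswap : ∫⁻ x, (∫⁻ θ, ∏ i ∈ S, arcDensity τ θ (x i) ∂unifCircle) *
        ∫⁻ θ, ∏ i ∈ S', arcDensity τ θ (x i) ∂unifCircle ∂nullLaw N =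
      ∫⁻ θ, ∫⁻ θ', ((ENNReal.ofReal τ)⁻¹ ^ 2 * unifCircle (arc τ θ ∩ arc τ θ')) ^ h
        ∂unifCircle ∂unifCircle := by
    simp_rw [hh, ← lintegral_prod_arcDensity_mul h0 hlt]
    have hx : ∀ x : Fin N → Angle, (∫⁻ θ, ∏ i ∈ S, arcDensity τ θ (x i) ∂unifCircle) *
        ∫⁻ θ, ∏ i ∈ S', arcDensity τ θ (x i) ∂unifCircle =
        ∫⁻ θ, ∫⁻ θ', (∏ i ∈ S, arcDensity τ θ (x i)) * ∏ i ∈ S', arcDensity τ θ' (x i)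
          ∂unifCircle ∂unifCircle := by
      intro x
      have hmx : ∀ S : Finset (Fin N), Measurable fun θ => ∏ i ∈ S, arcDensity τ θ (x i) :=
        fun S => (hm S).comp (measurable_id.prodMk measurable_const)
      simp_rw [lintegral_const_mul _ (hmx S')]
      rw [lintegral_mul_const _ (hmx S)]
    have hm3 : Measurable fun p : ((Fin N → Angle) × Angle) × Angle =>
        (∏ i ∈ S, arcDensity τ p.1.2 (p.1.1 i)) * ∏ i ∈ S', arcDensity τ p.2 (p.1.1 i) :=
      ((hm S).comp (f := fun p : ((Fin N → Angle) × Angle) × Angle => (p.1.2, p.1.1))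
        (by fun_prop)).mul
      ((hm S').comp (f := fun p : ((Fin N → Angle) × Angle) × Angle => (p.2, p.1.1))
        (by fun_prop))
    simp_rw [hx]
    rw [lintegral_lintegral_swap]
    · refine lintegral_congr fun θ => ?_
      rw [lintegral_lintegral_swap]
      exact (hm3.comp (g := fun p : ((Fin N → Angle) × Angle) × Angle =>
        (∏ i ∈ S, arcDensity τ p.1.2 (p.1.1 i)) * ∏ i ∈ S', arcDensity τ p.2 (p.1.1 i))
        (f := fun p : (Fin N → Angle) × Angle => ((p.1, θ), p.2)) (by fun_prop)).aemeasurable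
    · exact (Measurable.lintegral_prod_right' hm3).aemeasurable
  have hinner : ∀ θ, ∫⁻ θ', ((ENNReal.ofReal τ)⁻¹ ^ 2 * unifCircle (arc τ θ ∩ arc τ θ')) ^ h
        ∂unifCircle =
      ((ENNReal.ofReal τ)⁻¹ ^ 2) ^ h * ∫⁻ δ, unifCircle (arc τ 0 ∩ arc τ δ) ^ h ∂unifCircle := by
    intro θ
    have hfin : ((ENNReal.ofReal τ)⁻¹ ^ 2) ^ h ≠ ∞ := by
      have : ENNReal.ofReal τ ≠ 0 := by simpa using h0
      finiteness
    -- By rotation invariance only the relative phase matters.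
    rw [← lintegral_add_left_eq_self _ θ]
    simp_rw [unifCircle_arc_inter_add, mul_pow _ (unifCircle _)]
    rw [lintegral_const_mul' _ _ hfin]
  rw [hswap]
  simp_rw [hinner]
  rw [lintegral_const, measure_univ, mul_one]
  -- Disjoint sets give exactly 1, which the tent moment bound does not cover; the summand 1 in the
  -- claim lets one formula serve all `h`.
  rcases eq_or_ne h 0 with hz | hz
  · simp only [hz, pow_zero, one_mul, lintegral_const, measure_univ, Nat.cast_zero]
    rw [← ENNReal.ofReal_one]
    exact ENNReal.ofReal_le_ofReal (by linarith)
  · refine (mul_le_mul_right (lintegral_arc_inter_pow_le h0 h1 hz) _).trans ?_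
    rw [← ENNReal.ofReal_inv_of_pos h0, ← ENNReal.ofReal_pow (by positivity),
      ← ENNReal.ofReal_pow (by positivity), ← ENNReal.ofReal_mul (by positivity)]
    apply ENNReal.ofReal_le_ofReal
    have : ((τ⁻¹) ^ 2) ^ h * (2 * τ ^ (h + 1) / (h + 1)) =
        2 * τ * ((1 / τ) ^ h / (h + 1)) := by
      rw [one_div, inv_pow, inv_pow, inv_pow, ← pow_mul]
      field_simp
      ring
    rw [this]
    linarith

/-! ### Averaging over the size of the intersection -/

/-- The ratio of the binomial coefficients is the product of `(k - i)/(n - i)` over `i < j`, and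
each factor is at most `k/n`. -/
theorem choose_sub_le (j : ℕ) : ∀ {n k : ℕ}, j ≤ k → k ≤ n →
    ((n - j).choose (k - j) : ℝ) ≤ n.choose k * ((k : ℝ) / n) ^ j := by
  induction j with
  | zero => simp
  | succ j ih =>
    intro n k hjk hkn
    obtain ⟨k, rfl⟩ := Nat.exists_eq_add_of_le' (Nat.one_le_of_lt hjk)
    obtain ⟨n, rfl⟩ := Nat.exists_eq_add_of_le' (Nat.one_le_of_lt hkn)
    have hkn' : k ≤ n := by omega
    have hratio : (k : ℝ) / n ≤ ((k + 1 : ℕ) : ℝ) / (n + 1 : ℕ) := by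
      rcases Nat.eq_zero_or_pos n with rfl | hn
      · simp
        positivity
      · have hn' : (0 : ℝ) < n := by exact_mod_cast hn
        have hkn'' : (k : ℝ) ≤ n := by exact_mod_cast hkn'
        rw [div_le_div_iff₀ hn' (by positivity)]
        push_cast
        nlinarith
    have hch : (n.choose k : ℝ) = (n + 1).choose (k + 1) * (((k + 1 : ℕ) : ℝ) / (n + 1 : ℕ)) := by
      have : ((n + 1 : ℕ) : ℝ) * n.choose k = (n + 1).choose (k + 1) * (k + 1 : ℕ) := by
        exact_mod_cast Nat.add_one_mul_choose_eq n k
      rw [← mul_div_assoc, ← this, mul_div_cancel_left₀]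
      positivity
    rw [Nat.add_sub_add_right, Nat.add_sub_add_right]
    refine (ih (by omega) hkn').trans ?_
    rw [hch, pow_succ', mul_assoc]
    gcongr

theorem card_powersetCard_filter_superset_le {α : Type*} [Fintype α] [DecidableEq α]
    (J : Finset α) (k : ℕ) :
    (((Finset.univ : Finset α).powersetCard k).filter (J ⊆ ·)).card ≤
      (Fintype.card α - J.card).choose (k - J.card) := by
  rw [← Finset.card_compl, ← Finset.card_powersetCard]
  refine Finset.card_le_card_of_injOn (· \ J) (fun T hT => ?_) fun T hT T' hT' h => ?_
  · obtain ⟨hTk, hJT⟩ := Finset.mem_filter.1 hT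
    refine Finset.mem_coe.2 (Finset.mem_powersetCard.2 ⟨?_, ?_⟩)
    · exact fun i hi => Finset.mem_compl.2 (Finset.mem_sdiff.1 hi).2
    · rw [Finset.card_sdiff_of_subset hJT, (Finset.mem_powersetCard.1 hTk).2]
  · rw [← Finset.sdiff_union_of_subset (Finset.mem_filter.1 hT).2,
      ← Finset.sdiff_union_of_subset (Finset.mem_filter.1 hT').2]
    exact congrArg (· ∪ J) h

/-- The identity `(k + 1) C(k, j) = (j + 1) C(k + 1, j + 1)` absorbs the denominators and leaves the
expansion of `(1 + z)^(k + 1)` without its constant term. Weakening `k + 1` to `k` produces the `K²`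
of the converse condition. -/
theorem sum_choose_mul_pow_div_le {z : ℝ} (hz : 0 < z) {k : ℕ} (hk : 1 ≤ k) :
    ∑ j ∈ Finset.range (k + 1), (k.choose j : ℝ) * (z ^ j / (j + 1)) ≤
      (1 + z) ^ (k + 1) / (z * k) := by
  have hk' : (0 : ℝ) < k := by exact_mod_cast hk
  have hterm : ∀ j ∈ Finset.range (k + 1), (k.choose j : ℝ) * (z ^ j / (j + 1)) =
      (z * (k + 1))⁻¹ * (z ^ (j + 1) * (k + 1).choose (j + 1)) := by
    intro j _
    have : ((k : ℝ) + 1) * k.choose j = (k + 1).choose (j + 1) * (j + 1) := by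
      exact_mod_cast Nat.add_one_mul_choose_eq k j
    field_simp
    linear_combination z ^ (j + 1) * this
  rw [Finset.sum_congr rfl hterm, ← Finset.mul_sum]
  have hsum : ∑ j ∈ Finset.range (k + 1), z ^ (j + 1) * ((k + 1).choose (j + 1) : ℝ) ≤
      (1 + z) ^ (k + 1) := by
    rw [add_comm 1 z, add_pow, Finset.sum_range_succ' _ (k + 1)]
    simp only [one_pow, mul_one]
    exact le_add_of_nonneg_right (by positivity)
  calc (z * (k + 1))⁻¹ * ∑ j ∈ Finset.range (k + 1), z ^ (j + 1) * ((k + 1).choose (j + 1) : ℝ)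
      ≤ (z * k)⁻¹ * (1 + z) ^ (k + 1) := by
        gcongr
        linarith
    _ = _ := by rw [div_eq_inv_mul]

/-- Domination of the hypergeometric law by the binomial one. -/
theorem sum_powersetCard_pow_card_inter_div_le {n k : ℕ} (hk : 1 ≤ k) (hkn : k ≤ n)
    {S : Finset (Fin n)} (hS : S.card = k) {x : ℝ} (hx : 0 < x) :
    ∑ T ∈ (Finset.univ : Finset (Fin n)).powersetCard k,
        x ^ (S ∩ T).card / ((S ∩ T).card + 1 : ℝ) ≤
      n.choose k * ((1 + (k : ℝ) / n * x) ^ (k + 1) / ((k : ℝ) / n * x * k)) := by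
  have hk' : (0 : ℝ) < k := by exact_mod_cast hk
  have hn' : (0 : ℝ) < n := by exact_mod_cast hk.trans hkn
  calc ∑ T ∈ (Finset.univ : Finset (Fin n)).powersetCard k,
        x ^ (S ∩ T).card / ((S ∩ T).card + 1 : ℝ)
      ≤ ∑ T ∈ (Finset.univ : Finset (Fin n)).powersetCard k,
        ∑ J ∈ S.powerset, if J ⊆ T then x ^ J.card / (J.card + 1 : ℝ) else 0 := by
        -- Only `J = S ∩ T` is needed, but summing over all `J ⊆ S ∩ T` leaves just containment
        -- probabilities to estimate, and these are at most `(k/n)^|J|`.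
        refine Finset.sum_le_sum fun T _ => ?_
        refine le_trans (le_of_eq ?_) (Finset.single_le_sum
          (f := fun J : Finset (Fin n) => if J ⊆ T then x ^ J.card / (J.card + 1 : ℝ) else 0)
          (fun J _ => ?_) (Finset.mem_powerset.2 (Finset.inter_subset_left (s₂ := T))))
        · simp [Finset.inter_subset_right]
        · split_ifs <;> positivity
    _ = ∑ J ∈ S.powerset, (((Finset.univ : Finset (Fin n)).powersetCard k).filter (J ⊆ ·)).card *
          (x ^ J.card / (J.card + 1 : ℝ)) := by
        rw [Finset.sum_comm]
        refine Finset.sum_congr rfl fun J _ => ?_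
        rw [← Finset.sum_filter, Finset.sum_const, nsmul_eq_mul]
    _ ≤ ∑ J ∈ S.powerset, n.choose k * (((k : ℝ) / n * x) ^ J.card / (J.card + 1 : ℝ)) := by
        refine Finset.sum_le_sum fun J hJ => ?_
        have hJk : J.card ≤ k := hS ▸ Finset.card_le_card (Finset.mem_powerset.1 hJ)
        have h1 : ((((Finset.univ : Finset (Fin n)).powersetCard k).filter (J ⊆ ·)).card : ℝ) ≤
            n.choose k * ((k : ℝ) / n) ^ J.card := by
          refine le_trans ?_ (choose_sub_le J.card hJk hkn)
          have := card_powersetCard_filter_superset_le J k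
          rw [Fintype.card_fin] at this
          exact_mod_cast this
        rw [mul_pow, mul_div_assoc, ← mul_assoc]
        gcongr
    _ = n.choose k * ∑ j ∈ Finset.range (k + 1),
          (k.choose j : ℝ) * (((k : ℝ) / n * x) ^ j / (j + 1)) := by
        rw [← Finset.mul_sum, Finset.sum_powerset_apply_card
          (fun j : ℕ => ((k : ℝ) / n * x) ^ j / (j + 1 : ℝ)), hS]
        simp_rw [nsmul_eq_mul]
    _ ≤ _ := by
        gcongr
        exact sum_choose_mul_pow_div_le (by positivity) hk

/-! ### Second moment bound and the converse -/

theorem lintegral_likelihoodRatio_sq_le {N K : ℕ} {τ : ℝ} (hK : 1 ≤ K) (hKN : K ≤ N)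
    (h0 : 0 < τ) (h1 : τ ≤ 1 / 2) :
    ∫⁻ x, likelihoodRatio N K τ x ^ 2 ∂nullLaw N ≤
      ENNReal.ofReal (1 + 2 * (N : ℝ) * τ ^ 2 / (K : ℝ) ^ 2 *
        (1 + (K : ℝ) / ((N : ℝ) * τ)) ^ (K + 1)) := by
  have hK' : (0 : ℝ) < K := by exact_mod_cast hK
  have hN' : (0 : ℝ) < N := by exact_mod_cast hK.trans hKN
  have hC : (0 : ℝ) < N.choose K := by exact_mod_cast Nat.choose_pos hKN
  set χ := 2 * (N : ℝ) * τ ^ 2 / (K : ℝ) ^ 2 * (1 + (K : ℝ) / ((N : ℝ) * τ)) ^ (K + 1) with hχ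
  have hχ0 : 0 ≤ χ := by positivity
  set 𝒮 := (Finset.univ : Finset (Fin N)).powersetCard K with h𝒮
  have hcard : 𝒮.card = N.choose K := by rw [h𝒮, Finset.card_powersetCard, Finset.card_fin]
  have hm : ∀ S T : Finset (Fin N), Measurable fun x : Fin N → Angle =>
      (∫⁻ θ, ∏ i ∈ S, arcDensity τ θ (x i) ∂unifCircle) *
        ∫⁻ θ, ∏ i ∈ T, arcDensity τ θ (x i) ∂unifCircle := fun S T =>
    (measurable_lintegral_prod_arcDensity τ S).mul (measurable_lintegral_prod_arcDensity τ T)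
  have hinner : ∀ S ∈ 𝒮, ∑ T ∈ 𝒮,
      (1 + 2 * τ * ((1 / τ) ^ (S ∩ T).card / ((S ∩ T).card + 1 : ℝ))) ≤ N.choose K * (1 + χ) := by
    intro S hS
    have hz : (K : ℝ) / N * (1 / τ) = K / (N * τ) := by ring
    have := sum_powersetCard_pow_card_inter_div_le hK hKN (Finset.mem_powersetCard.1 hS).2
      (one_div_pos.2 h0)
    rw [hz] at this
    rw [Finset.sum_add_distrib, ← Finset.mul_sum, Finset.sum_const, hcard, nsmul_eq_mul, mul_one,
      mul_add, mul_one]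
    refine add_le_add le_rfl ?_
    refine (mul_le_mul_of_nonneg_left this (by positivity)).trans_eq ?_
    rw [hχ]
    -- With `z = K/(Nτ)`, the prefactor is `2τ/(zK) = 2Nτ²/K²`.
    generalize (1 + (K : ℝ) / (N * τ)) ^ (K + 1) = Z
    field_simp
  have hsq : ∀ x, likelihoodRatio N K τ x ^ 2 = (N.choose K : ℝ≥0∞)⁻¹ ^ 2 * ∑ S ∈ 𝒮, ∑ T ∈ 𝒮,
      (∫⁻ θ, ∏ i ∈ S, arcDensity τ θ (x i) ∂unifCircle) *
        ∫⁻ θ, ∏ i ∈ T, arcDensity τ θ (x i) ∂unifCircle := by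
    intro x
    rw [likelihoodRatio, mul_pow, pow_two (∑ S ∈ _, _), Finset.sum_mul_sum]
  simp_rw [hsq]
  rw [lintegral_const_mul _ (Finset.measurable_sum _ fun S _ => Finset.measurable_sum _ fun T _ =>
    hm S T), lintegral_finsetSum _ fun S _ => Finset.measurable_sum _ fun T _ => hm S T]
  simp_rw [lintegral_finsetSum 𝒮 fun T _ => hm _ T]
  have hsum : ∑ S ∈ 𝒮, ∑ T ∈ 𝒮, ∫⁻ x, (∫⁻ θ, ∏ i ∈ S, arcDensity τ θ (x i) ∂unifCircle) *
        ∫⁻ θ, ∏ i ∈ T, arcDensity τ θ (x i) ∂unifCircle ∂nullLaw N ≤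
      ENNReal.ofReal (N.choose K * (N.choose K * (1 + χ))) := by
    calc _ ≤ ∑ S ∈ 𝒮, ∑ T ∈ 𝒮, ENNReal.ofReal
          (1 + 2 * τ * ((1 / τ) ^ (S ∩ T).card / ((S ∩ T).card + 1 : ℝ))) :=
          Finset.sum_le_sum fun S _ => Finset.sum_le_sum fun T _ =>
            lintegral_mul_lintegral_prod_arcDensity_le h0 h1 S T
      _ ≤ ∑ S ∈ 𝒮, ENNReal.ofReal (N.choose K * (1 + χ)) := by
          refine Finset.sum_le_sum fun S hS => ?_
          rw [← ENNReal.ofReal_sum_of_nonneg fun T _ => by positivity]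
          exact ENNReal.ofReal_le_ofReal (hinner S hS)
      _ = _ := by
          rw [Finset.sum_const, hcard, nsmul_eq_mul, ENNReal.ofReal_mul hC.le,
            ENNReal.ofReal_mul hC.le, ENNReal.ofReal_mul hC.le, ENNReal.ofReal_natCast]
  refine (mul_le_mul_right hsum _).trans_eq ?_
  rw [← ENNReal.ofReal_natCast, ← ENNReal.ofReal_inv_of_pos hC,
    ← ENNReal.ofReal_pow (by positivity), ← ENNReal.ofReal_mul (by positivity)]
  congr 1
  field_simp

theorem weakDetectionImpossible_of_tendsto {K : ℕ → ℕ} {τ : ℕ → ℝ}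
    (hK : ∀ᶠ N in atTop, 1 ≤ K N ∧ K N ≤ N) (hτ : ∀ᶠ N in atTop, 0 < τ N ∧ τ N < 1)
    (hτ2 : ∀ᶠ N in atTop, τ N ≤ 1 / 2)
    (h : Tendsto (fun N : ℕ => 2 * (N : ℝ) * (τ N) ^ 2 / (K N : ℝ) ^ 2 *
      (1 + (K N : ℝ) / ((N : ℝ) * τ N)) ^ (K N + 1)) atTop (𝓝 0)) :
    WeakDetectionImpossible K τ := by
  intro φ hφ ε hε
  filter_upwards [hK, hτ, hτ2, h.eventually_le_const (by positivity : (0 : ℝ) < ε ^ 2)]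
    with N hKN hτN hτ2N hχ
  have hP := isProbabilityMeasure_plantedLaw hτN.1 hτN.2 hKN.2
  have hA : MeasurableSet {x | φ N x = true} := hφ N (measurableSet_singleton true)
  have hcompl : {x | φ N x = false} = {x | φ N x = true}ᶜ := by
    ext x
    simp
  rw [pMiss, hcompl, probReal_compl_eq_one_sub hA, pFalseAlarm]
  have hPd := plantedLaw_eq_withDensity (N := N) (K := K N) hτN.1 hτN.2
  rw [hPd] at hP ⊢
  have := hτN.1
  have hle := real_le_real_add_of_lintegral_sq_le (measurable_likelihoodRatio N (K N) (τ N))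
    (by positivity) hε hχ (lintegral_likelihoodRatio_sq_le hKN.1 hKN.2 hτN.1 hτ2N) hA
  linarith

end HardCluster

/-- Detection thresholds in the hard-cluster flat model with parameters `(N, K, τ)`, where
`K = K N` and `τ = τ N` are sequences: achievability (A1), (A2) by the interval test, and the
converse. -/
theorem theorem1 (K : ℕ → ℕ) (τ : ℕ → ℝ)
    (hK : ∀ᶠ N in atTop, 1 ≤ K N ∧ K N ≤ N)
    (hτ : ∀ᶠ N in atTop, 0 < τ N ∧ τ N < 1) :
    -- (A1)
    (Tendsto (fun N : ℕ => (N : ℝ) ^ (K N) * (τ N) ^ (K N - 1) / ((K N - 1).factorial : ℝ))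
        atTop (𝓝 0) →
      HardCluster.AchievesStrongDetection K τ
        (fun N => HardCluster.intervalTest (τ N) (K N : ℝ))) ∧
    -- (A2)
    (∀ c γ : ℕ → ℝ, Tendsto c atTop atTop →
      (∀ N : ℕ, γ N = ((N : ℝ) - K N) * τ N + K N - c N * √(((N : ℝ) - K N) * τ N)) →
      (∀ᶠ N : ℕ in atTop, 1 + ((N : ℝ) - 1) * τ N ≤ γ N) →
      Tendsto (fun N : ℕ => ((K N : ℝ) - 1) ^ 2 * (1 - τ N) ^ 2 / (((N : ℝ) - K N) * τ N))
        atTop atTop →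
      Tendsto (fun N : ℕ =>
          ((K N : ℝ) * (1 - τ N) - c N * √(((N : ℝ) - K N) * τ N)) ^ 2 /
            (2 * N * τ N + K N * (1 - τ N) - c N * √(((N : ℝ) - K N) * τ N)) - Real.log N)
        atTop atTop →
      HardCluster.AchievesStrongDetection K τ
        (fun N => HardCluster.intervalTest (τ N) (γ N))) ∧
    -- (b)
    ((∀ᶠ N in atTop, τ N ≤ 1 / 2) →
      Tendsto (fun N : ℕ => 2 * (N : ℝ) * (τ N) ^ 2 / (K N : ℝ) ^ 2 *
          (1 + (K N : ℝ) / ((N : ℝ) * τ N)) ^ (K N + 1)) atTop (𝓝 0) →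
      HardCluster.WeakDetectionImpossible K τ) := by
  exact ⟨HardCluster.achievesStrongDetection_card hK hτ,
    fun _ _ hc hγ hγ1 h1 h2 =>
      HardCluster.achievesStrongDetection_shifted hK hτ hc hγ hγ1 h1 h2,
    HardCluster.weakDetectionImpossible_of_tendsto hK hτ⟩
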